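/- For $q\in\mathbb{C}\setminus\{0\}$ and an integer $n\ge 0$ let $U'_q(\mathrm{so}_n)$ be the unital associative algebra over $\mathbb{C}$ generated by $I_{21},I_{32},\dots,I_{n,n-1}$ subject to the relations $$I_{i,i-1}^2I_{i+1,i}-(q+q^{-1})I_{i,i-1}I_{i+1,i}I_{i,i-1}+I_{i+1,i}I_{i,i-1}^2=-I_{i+1,i},$$ $$I_{i,i-1}I_{i+1,i}^2-(q+q^{-1})I_{i+1,i}I_{i,i-1}I_{i+1,i}+I_{i+1,i}^2I_{i,i-1}=-I_{i,i-1},$$ $$I_{i,i-1}I_{j,j-1}-I_{j,j-1}I_{i,i-1}=0\quad\text{for } |i-j|>1.$$ **Theorem 5.** For all integers $n\ge 0$ and $k\ge 1$ there is an integer $r\geq 0$, depending only on $n$ and $k$, such that the following holds for every complex number $q$ with $q^k=1$ and $q^4\ne 1$ (in particular for every $q\neq 1$ with $q^k=1$ and $k$ odd). The algebra $U'_q(\mathrm{so}_n)$ is a finitely generated module over its center, and every irreducible representation of $U'_q(\mathrm{so}_n)$ on a complex vector space (not assumed finite-dimensional) is finite-dimensional, of dimension at most $r$. -/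

import Mathlib

/-- The defining relations of the nonstandard `q`-deformation `U'_q(so_n)`. The free generator
with (zero-based) index `i : Fin (n - 1)` is `I_{i+2,i+1}`, so the generators are
`I_{21}, I_{32}, …, I_{n,n-1}`. -/
inductive UqSoRel (q : ℂ) (n : ℕ) :
    FreeAlgebra ℂ (Fin (n - 1)) → FreeAlgebra ℂ (Fin (n - 1)) → Prop
  | serre_left (i j : Fin (n - 1)) (h : (j : ℕ) = (i : ℕ) + 1) :
      UqSoRel q n
        (FreeAlgebra.ι ℂ i ^ 2 * FreeAlgebra.ι ℂ j
          - (q + q⁻¹) • (FreeAlgebra.ι ℂ i * FreeAlgebra.ι ℂ j * FreeAlgebra.ι ℂ i)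
          + FreeAlgebra.ι ℂ j * FreeAlgebra.ι ℂ i ^ 2)
        (-FreeAlgebra.ι ℂ j)
  | serre_right (i j : Fin (n - 1)) (h : (j : ℕ) = (i : ℕ) + 1) :
      UqSoRel q n
        (FreeAlgebra.ι ℂ i * FreeAlgebra.ι ℂ j ^ 2
          - (q + q⁻¹) • (FreeAlgebra.ι ℂ j * FreeAlgebra.ι ℂ i * FreeAlgebra.ι ℂ j)
          + FreeAlgebra.ι ℂ j ^ 2 * FreeAlgebra.ι ℂ i)
        (-FreeAlgebra.ι ℂ i)
  | comm (i j : Fin (n - 1)) (h : 1 < |((i : ℕ) : ℤ) - ((j : ℕ) : ℤ)|) :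
      UqSoRel q n
        (FreeAlgebra.ι ℂ i * FreeAlgebra.ι ℂ j - FreeAlgebra.ι ℂ j * FreeAlgebra.ι ℂ i) 0

/-- The nonstandard `q`-deformation `U'_q(so_n)`: the unital associative complex algebra
generated by `I_{21}, …, I_{n,n-1}` subject to the relations `UqSoRel q n`. -/
abbrev UqSo (q : ℂ) (n : ℕ) : Type := RingQuot (UqSoRel q n)

/-!
Fix a square root `p` of `q` and number the vertices of a polygon `0, …, n - 1`. To every chord
`l < k` belongs an element `chord p g l k` of `U'_q(so_n)` (the element `I_{k,l}` of Gavrilik and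
Klimyk), built from the generators, which are the chords of length one, by iterated `q`-commutators.

* *Relations.* Chords sharing an end point form cyclic triples `[x, y]_q = z`, `[y, z]_q = x`,
  `[z, x]_q = y`; disjoint chords that do not cross commute; the commutator of two crossing chords
  is a combination of products of opposite sides. All of this reduces to four points
  (`IsFourPoint`), where it follows by moving one chord past another in two ways; this uses
  `q + q⁻¹ ≠ 0`.
* *Center.* If `q ^ k = 1`, the Chebyshev polynomial `C_k` of `(q - q⁻¹) x` commutes with `y` and
  `z` for every cyclic triple (`aeval_chebyshev_C_mul`). As every generator commutes with a given
  chord or forms a cyclic triple with it, a polynomial of degree exactly `k` in each chord is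
  central.
* *Finiteness.* Give a chord of length `d` the weight `d (2 n - d)`. By strict concavity, any two
  chords commute up to a scalar and terms of smaller weight
  (`IsSoGenerators.quasiCommutes_chords`). In a word with more than `N (k - 1)` letters, `N` being
  the number of chords, some chord occurs `k` times. These occurrences can be collected, and their
  product replaced by a central element and lower powers, so words of length at most `N (k - 1)`
  generate the algebra over its center (`span_center_short_words`). No linear independence is
  needed.
* *Representations.* The algebra has countable dimension over `ℂ`, so by Nakayama's lemma and the
  uncountability of `ℂ` the center acts on a simple module by scalars, and the same words span the
  module over `ℂ` (`finrank_le_of_span_center`). Their number depends only on `n` and `k`.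
-/

/-! ### The relations between the chords -/

section Brackets

set_option linter.unusedSimpArgs false
set_option linter.unnecessarySeqFocus false

variable {A : Type*} [Ring A] [Algebra ℂ A]

/-- The `q`-commutator `[x, y]_q = q^{1/2} x y - q^{-1/2} y x`, with `p` in the role of
`q^{1/2}`. -/
noncomputable def qBracket (p : ℂ) (x y : A) : A := p • (x * y) - p⁻¹ • (y * x)

/-- `x, y, z` satisfy the cyclic relations `[x, y]_q = z`, `[y, z]_q = x`, `[z, x]_q = y`, which
present `U'_q(so_3)` symmetrically; `p` is a square root of `q`. -/
structure IsCyclicTriple (p : ℂ) (x y z : A) : Prop where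
  left : qBracket p x y = z
  middle : qBracket p y z = x
  right : qBracket p z x = y

variable {p : ℂ} {x y z a b c d e f : A}

lemma IsCyclicTriple.rotate (h : IsCyclicTriple p x y z) : IsCyclicTriple p y z x :=
  ⟨h.middle, h.right, h.left⟩

lemma isCyclicTriple_of_serre (hp : p ≠ 0)
    (hxy : x ^ 2 * y - (p ^ 2 + (p ^ 2)⁻¹) • (x * y * x) + y * x ^ 2 = -y)
    (hyx : x * y ^ 2 - (p ^ 2 + (p ^ 2)⁻¹) • (y * x * y) + y ^ 2 * x = -x) :
    IsCyclicTriple p x y (qBracket p x y) := by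
  refine ⟨rfl, ?_, ?_⟩
  · unfold qBracket
    linear_combination (norm := skip) (-1 : ℂ) • hyx
    simp only [pow_two, mul_sub, sub_mul, smul_mul_assoc, mul_smul_comm, mul_assoc]
    match_scalars <;> field_simp <;> ring
  · unfold qBracket
    linear_combination (norm := skip) (-1 : ℂ) • hxy
    simp only [pow_two, mul_sub, sub_mul, smul_mul_assoc, mul_smul_comm, mul_assoc]
    match_scalars <;> field_simp <;> ring

lemma qBracket_mul_left (hp : p ≠ 0) (h : qBracket p x y = z) :
    x * y = (p ^ 2)⁻¹ • (y * x) + p⁻¹ • z := by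
  rw [← h, qBracket]; match_scalars <;> field_simp <;> ring

lemma qBracket_mul_right (hp : p ≠ 0) (h : qBracket p x y = z) :
    y * x = p ^ 2 • (x * y) - p • z := by
  rw [← h, qBracket]; match_scalars <;> field_simp <;> ring

/-- The `q`-commutator is associative when the outer entries commute. -/
lemma qBracket_assoc (h : Commute x z) :
    qBracket p (qBracket p x y) z = qBracket p x (qBracket p y z) := by
  have h := h.eq
  unfold qBracket
  have h1 : x * z * y = z * x * y := by rw [h]
  have h2 : y * (x * z) = y * (z * x) := by rw [h]
  linear_combination (norm := skip) (p * p⁻¹) • h1 - (p * p⁻¹) • h2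
  simp only [mul_add, mul_sub, add_mul, sub_mul, smul_mul_assoc, mul_smul_comm, mul_assoc]
  match_scalars <;> ring

lemma qBracket_left_comm (h : Commute x y) :
    qBracket p y (qBracket p x z) = qBracket p x (qBracket p y z) := by
  have h := h.eq
  unfold qBracket
  have h1 : x * y * z = y * x * z := by rw [h]
  have h2 : z * (x * y) = z * (y * x) := by rw [h]
  linear_combination (norm := skip) (p⁻¹ * p⁻¹) • h2 - (p * p) • h1
  simp only [mul_add, mul_sub, add_mul, sub_mul, smul_mul_assoc, mul_smul_comm, mul_assoc]
  match_scalars <;> ring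

lemma qBracket_right_comm (h : Commute x y) :
    qBracket p (qBracket p z x) y = qBracket p (qBracket p z y) x := by
  have h := h.eq
  unfold qBracket
  have h1 : x * y * z = y * x * z := by rw [h]
  have h2 : z * (x * y) = z * (y * x) := by rw [h]
  linear_combination (norm := skip) (p * p) • h2 - (p⁻¹ * p⁻¹) • h1
  simp only [mul_add, mul_sub, add_mul, sub_mul, smul_mul_assoc, mul_smul_comm, mul_assoc]
  match_scalars <;> ring

/-- Reordering `b f` through `f = [a, e]_q`. -/
lemma middle_mul_outer_of_left (hp : p ≠ 0) (habd : IsCyclicTriple p a b d)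
    (hbce : IsCyclicTriple p b c e) (hac : Commute a c) (hf : qBracket p a e = f) :
    b * f = p ^ 4 • (f * b) + (1 - p ^ 4) • (a * c) - p ^ 2 • (d * e - e * d) := by
  have B1 := qBracket_mul_right hp habd.left
  have B2 := qBracket_mul_right hp hbce.right
  have hac := hac.eq
  rw [← hf, qBracket]
  linear_combination (norm := skip) p • (B1 * e) + (p * p ^ 2) • (a * B2) - p⁻¹ • (B2 * a)
    - (p⁻¹ * p ^ 2) • (e * B1) - hac
  simp only [mul_add, mul_sub, add_mul, sub_mul, smul_mul_assoc, mul_smul_comm, mul_assoc]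
  match_scalars <;> field_simp <;> ring

/-- Reordering `b f` through `f = [d, c]_q`. -/
lemma middle_mul_outer_of_right (hp : p ≠ 0) (habd : IsCyclicTriple p a b d)
    (hbce : IsCyclicTriple p b c e) (hac : Commute a c) (hf : qBracket p d c = f) :
    b * f = (p ^ 4)⁻¹ • (f * b) + (1 - (p ^ 4)⁻¹) • (a * c) + (p ^ 2)⁻¹ • (d * e - e * d) := by
  have B1 := qBracket_mul_left hp habd.middle
  have B2 := qBracket_mul_left hp hbce.left
  have hac := hac.eq
  rw [← hf, qBracket]
  linear_combination (norm := skip) p • (B1 * c) + (p * (p ^ 2)⁻¹) • (d * B2) - p⁻¹ • (B2 * d)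
    - (p⁻¹ * (p ^ 2)⁻¹) • (c * B1) + (p ^ 4)⁻¹ • hac
  simp only [mul_add, mul_sub, add_mul, sub_mul, smul_mul_assoc, mul_smul_comm, mul_assoc]
  match_scalars <;> field_simp <;> ring

/-- The configuration of the six chords on four points in `U'_q(so_4)`: `a, b, c` are the three
consecutive sides, `d, e` the two crossing diagonals and `f` the outer side. -/
structure IsFourPoint (p : ℂ) (a b c d e f : A) : Prop where
  abd : IsCyclicTriple p a b d
  bce : IsCyclicTriple p b c e
  comm : Commute a c
  outer : qBracket p a e = f

namespace IsFourPoint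

lemma outer' (h : IsFourPoint p a b c d e f) : qBracket p d c = f := by
  rw [← h.outer, ← h.bce.left, ← qBracket_assoc h.comm, h.abd.left]

/-- The two expressions of `b f` differ by the crossing commutator `d e - e d` with opposite signs;
eliminating it leaves `(q + q⁻¹) (b f - f b) = 0`, which is where `q² ≠ -1` is needed. -/
lemma commute_middle_outer (h : IsFourPoint p a b c d e f) (hp : p ≠ 0) (hp8 : p ^ 8 ≠ 1) :
    Commute b f := by
  have h1 := middle_mul_outer_of_left hp h.abd h.bce h.comm h.outer
  have h2 := middle_mul_outer_of_right hp h.abd h.bce h.comm h.outer'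
  have hq : p ^ 4 + 1 ≠ 0 := fun h0 => hp8 (by linear_combination (p ^ 4 - 1) * h0)
  have h3 : (p ^ 4 + 1) • (b * f) = (p ^ 4 + 1) • (f * b) := by
    linear_combination (norm := skip) h1 + p ^ 4 • h2
    match_scalars <;> field_simp <;> ring
  exact smul_right_injective A hq h3

lemma crossing (h : IsFourPoint p a b c d e f) (hp : p ≠ 0) (hp8 : p ^ 8 ≠ 1) :
    d * e - e * d = (p ^ 2 - (p ^ 2)⁻¹) • (f * b - a * c) := by
  have h1 := middle_mul_outer_of_left hp h.abd h.bce h.comm h.outer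
  rw [(h.commute_middle_outer hp hp8).eq] at h1
  linear_combination (norm := skip) (p ^ 2)⁻¹ • h1
  match_scalars <;> field_simp <;> ring

lemma qBracket_c_f (h : IsFourPoint p a b c d e f) : qBracket p c f = d := by
  rw [← h.outer, qBracket_left_comm h.comm, h.bce.middle, h.abd.left]

lemma qBracket_f_a (h : IsFourPoint p a b c d e f) : qBracket p f a = e := by
  rw [← h.outer', qBracket_right_comm h.comm.symm, h.abd.right, h.bce.left]

lemma triple_dcf (h : IsFourPoint p a b c d e f) (hp : p ≠ 0) (hp8 : p ^ 8 ≠ 1) :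
    IsCyclicTriple p d c f := by
  refine ⟨h.outer', h.qBracket_c_f, ?_⟩
  -- Write `d = [a, b]_q`, `c = [e, b]_q` and move `f` past `a` and `b`.
  have H1 := qBracket_mul_left hp h.qBracket_f_a
  have H2 := (h.commute_middle_outer hp hp8).eq
  rw [← h.abd.left]
  conv_rhs => rw [← h.bce.right]
  unfold qBracket
  linear_combination (norm := skip) p ^ 2 • (H1 * b) - a * H2 + H2 * a - b * H1
  simp only [mul_add, mul_sub, add_mul, sub_mul, smul_mul_assoc, mul_smul_comm, mul_assoc]
  match_scalars <;> field_simp <;> ring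

lemma triple_aef (h : IsFourPoint p a b c d e f) (hp : p ≠ 0) (hp8 : p ^ 8 ≠ 1) :
    IsCyclicTriple p a e f := by
  refine ⟨h.outer, ?_, h.qBracket_f_a⟩
  -- Write `e = [b, c]_q`, `a = [b, d]_q` and move `f` past `c` and `b`.
  have H1 := qBracket_mul_left hp h.qBracket_c_f
  have H2 := (h.commute_middle_outer hp hp8).eq
  rw [← h.bce.left]
  conv_rhs => rw [← h.abd.middle]
  unfold qBracket
  linear_combination (norm := skip) p ^ 2 • (b * H1) - c * H2 + H2 * c - H1 * b
  simp only [mul_add, mul_sub, add_mul, sub_mul, smul_mul_assoc, mul_smul_comm, mul_assoc]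
  match_scalars <;> field_simp <;> ring

end IsFourPoint

lemma Commute.qBracket_right (hy : Commute x y) (hz : Commute x z) :
    Commute x (qBracket p y z) :=
  ((hy.mul_right hz).smul_right _).sub_right ((hz.mul_right hy).smul_right _)

/-- `g 0, …, g (N - 1)` satisfy the defining relations of `U'_q(so_{N+1})`, the Serre-type relations
being written with `q`-commutators. -/
structure IsSoGenerators (p : ℂ) (N : ℕ) (g : ℕ → A) : Prop where
  triple : ∀ i, i + 1 < N → IsCyclicTriple p (g i) (g (i + 1)) (qBracket p (g i) (g (i + 1)))
  comm : ∀ i j, i + 1 < j → j < N → Commute (g i) (g j)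

/-- Auxiliary recursion for `chord`: `chordAux p g d l` joins the vertices `l` and `l + d + 1`. -/
noncomputable def chordAux (p : ℂ) (g : ℕ → A) : ℕ → ℕ → A
  | 0, l => g l
  | d + 1, l => qBracket p (g l) (chordAux p g d (l + 1))

/-- The element `I_{k,l}` of Gavrilik and Klimyk attached to the chord from the vertex `l` to the
vertex `k` of a polygon, for `l < k`. Vertices are numbered from `0` and
`chord p g l (l + 1) = g l`; the value for `k ≤ l` is irrelevant. -/
noncomputable def chord (p : ℂ) (g : ℕ → A) (l k : ℕ) : A := chordAux p g (k - l - 1) l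

variable {g : ℕ → A} {N : ℕ}

@[simp] lemma chord_succ (l : ℕ) : chord p g l (l + 1) = g l := by
  simp [chord, chordAux]

lemma chord_step {l k : ℕ} (h : l + 1 < k) :
    chord p g l k = qBracket p (g l) (chord p g (l + 1) k) := by
  obtain ⟨d, rfl⟩ := Nat.exists_eq_add_of_lt h
  have h1 : l + 1 + d + 1 - l - 1 = d + 1 := by omega
  have h2 : l + 1 + d + 1 - (l + 1) - 1 = d := by omega
  rw [chord, chord, h1, h2, chordAux]

lemma commute_chord {l k : ℕ} (hlk : l < k) (h : ∀ i, l ≤ i → i < k → Commute x (g i)) :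
    Commute x (chord p g l k) := by
  obtain ⟨d, rfl⟩ := Nat.exists_eq_add_of_lt hlk
  induction d generalizing l with
  | zero => simpa using h l le_rfl hlk
  | succ d ih =>
    rw [chord_step (by omega)]
    have hk : l + (d + 1) + 1 = l + 1 + d + 1 := by omega
    rw [hk] at h ⊢
    exact (h l le_rfl (by omega)).qBracket_right
      (ih (by omega) fun i hi1 hi2 => h i (by omega) hi2)

namespace IsSoGenerators

variable (hg : IsSoGenerators p N g)
include hg

lemma commute_of_separated {l k r s : ℕ} (h1 : l < k) (h2 : k < r) (h3 : r < s) (h4 : s ≤ N) :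
    Commute (chord p g l k) (chord p g r s) := by
  refine commute_chord h3 fun j hj1 hj2 => (commute_chord h1 fun i hi1 hi2 => ?_).symm
  exact (hg.comm i j (by omega) (by omega)).symm

lemma isFourPoint_of_triples {l m n k : ℕ} (h1 : l < m) (h2 : m < n) (h3 : n < k) (h4 : k ≤ N)
    (habd : IsCyclicTriple p (chord p g l m) (chord p g m n) (chord p g l n))
    (hbce : IsCyclicTriple p (chord p g m n) (chord p g n k) (chord p g m k))
    (h : qBracket p (chord p g l m) (chord p g m k) = chord p g l k) :
    IsFourPoint p (chord p g l m) (chord p g m n) (chord p g n k) (chord p g l n) (chord p g m k)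
      (chord p g l k) :=
  ⟨habd, hbce, hg.commute_of_separated h1 h2 h3 h4, h⟩

/-- By induction on the length of the longest chord: a left side of length at least two, or else a
right side of length at least two, is cut into its first edge and the rest, and the four-point
relations are applied to the resulting four vertices. -/
lemma chord_triple (hp : p ≠ 0) (hp8 : p ^ 8 ≠ 1) {l m k : ℕ} (h1 : l < m) (h2 : m < k)
    (h3 : k ≤ N) : IsCyclicTriple p (chord p g l m) (chord p g m k) (chord p g l k) := by
  induction hs : k - l using Nat.strong_induction_on generalizing l m k with | _ s ih
  by_cases hm : l + 1 = m
  · subst hm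
    by_cases hk : l + 1 + 1 = k
    · subst hk
      rw [chord_step h2, chord_succ, chord_succ]
      exact hg.triple l (by omega)
    · exact (hg.isFourPoint_of_triples h1 (Nat.lt_succ_self _) (by omega) h3
        (ih _ (by omega) h1 (Nat.lt_succ_self _) (by omega) rfl)
        (ih _ (by omega) (Nat.lt_succ_self _) (by omega) h3 rfl)
        (by rw [chord_succ, ← chord_step h2])).triple_aef hp hp8
  · exact (hg.isFourPoint_of_triples (Nat.lt_succ_self _) (by omega) h2 h3
      (ih _ (by omega) (Nat.lt_succ_self _) (by omega) (by omega) rfl)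
      (ih _ (by omega) (by omega) h2 h3 rfl)
      (by rw [chord_succ, ← chord_step (by omega)])).triple_dcf hp hp8

lemma isFourPoint (hp : p ≠ 0) (hp8 : p ^ 8 ≠ 1) {l m n k : ℕ} (h1 : l < m) (h2 : m < n)
    (h3 : n < k) (h4 : k ≤ N) :
    IsFourPoint p (chord p g l m) (chord p g m n) (chord p g n k) (chord p g l n) (chord p g m k)
      (chord p g l k) :=
  hg.isFourPoint_of_triples h1 h2 h3 h4 (hg.chord_triple hp hp8 h1 h2 (by omega))
    (hg.chord_triple hp hp8 h2 h3 h4) (hg.chord_triple hp hp8 h1 (by omega) h4).left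

end IsSoGenerators

end Brackets

/-! ### Central Chebyshev polynomials -/

section Chebyshev

set_option linter.unusedSimpArgs false
set_option linter.unnecessarySeqFocus false

open Polynomial

variable {A : Type*} [Ring A] [Algebra ℂ A] {p : ℂ} {x y z : A}

/-- With `u = (q - q⁻¹) x`, left multiplication by `u` on the span of `y` and `z` over polynomials
in `u` acting from the right is a `2 × 2` matrix. If `u = t + t⁻¹` on the right, its eigenvalues are
`q t + (q t)⁻¹` and `q⁻¹ t + (q⁻¹ t)⁻¹`. Hence the rescaled Chebyshev polynomial `C_m`,
characterized by `C_m (t + t⁻¹) = t ^ m + t ^ (-m)`, acts from the left as stated; on `y` this is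
right multiplication by `C_m u` when `q ^ m = 1`. -/
lemma aeval_chebyshev_C_mul (hp : p ≠ 0) (hz : qBracket p x y = z) (hy : qBracket p z x = y)
    (m : ℕ) {u : A} (hu : u = (p ^ 2 - (p ^ 2)⁻¹) • x) :
    aeval u (Chebyshev.C ℂ m) * y =
      y * ((p ^ 2)⁻¹ ^ m • aeval u (Chebyshev.S ℂ m)
          - (p ^ 2) ^ m • aeval u (Chebyshev.S ℂ (m - 2)))
      + (p⁻¹ * ((p ^ 2) ^ m - (p ^ 2)⁻¹ ^ m)) • (z * aeval u (Chebyshev.S ℂ (m - 1))) := by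
  have huy : u * y = (p ^ 2)⁻¹ • (y * u) + ((p ^ 2 - (p ^ 2)⁻¹) * p⁻¹) • z := by
    have := qBracket_mul_left hp hz
    rw [hu, smul_mul_assoc, this, mul_smul_comm]
    module
  have huz : u * z = (p ^ 2) • (z * u) - ((p ^ 2 - (p ^ 2)⁻¹) * p) • y := by
    have := qBracket_mul_right hp hy
    rw [hu, smul_mul_assoc, this, mul_smul_comm]
    module
  induction m using Nat.twoStepInduction with
  | zero =>
    have h2 : aeval u (2 : ℂ[X]) = 2 := map_ofNat _ 2
    simp [Chebyshev.S_neg_two, h2, two_mul, mul_add, add_mul]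
  | one =>
    simp [Chebyshev.S_neg_one, huy]
    match_scalars <;> field_simp
  | more m ih0 ih1 =>
    have hC := congrArg (aeval u) (Chebyshev.C_add_two ℂ (m : ℤ))
    have hS0 := congrArg (aeval u) (Chebyshev.S_eq ℂ (m : ℤ))
    have hS1 := congrArg (aeval u) (Chebyshev.S_add_one ℂ (m : ℤ))
    have hS2 := congrArg (aeval u) (Chebyshev.S_add_two ℂ (m : ℤ))
    have e1 : ((m + 1 : ℕ) : ℤ) = m + 1 := by push_cast; ring
    have e2 : ((m + 2 : ℕ) : ℤ) = m + 2 := by push_cast; ring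
    have e3 : ((m : ℤ) + 1 - 2) = m - 1 := by ring
    have e4 : ((m : ℤ) + 1 - 1) = m := by ring
    have e5 : ((m : ℤ) + 2 - 2) = m := by ring
    have e6 : ((m : ℤ) + 2 - 1) = m + 1 := by ring
    rw [e1, e3, e4] at ih1
    rw [e2, e5, e6, hC]
    simp only [map_sub, map_mul, aeval_X] at hS0 hS1 hS2 ⊢
    rw [sub_mul, mul_assoc, ih1, ih0, hS2, hS1, hS0]
    generalize aeval u (Chebyshev.S ℂ ((m : ℤ) - 1)) = s1
    generalize aeval u (Chebyshev.S ℂ ((m : ℤ) - 2)) = s2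
    have key1 : ∀ t, u * (y * t) =
        (p ^ 2)⁻¹ • (y * (u * t)) + ((p ^ 2 - (p ^ 2)⁻¹) * p⁻¹) • (z * t) := by
      intro t
      rw [← mul_assoc, huy, add_mul]
      simp only [smul_mul_assoc, mul_assoc]
    have key2 : ∀ t, u * (z * t) =
        (p ^ 2) • (z * (u * t)) - ((p ^ 2 - (p ^ 2)⁻¹) * p) • (y * t) := by
      intro t
      rw [← mul_assoc, huz, sub_mul]
      simp only [smul_mul_assoc, mul_assoc]
    simp only [mul_add, mul_sub, smul_mul_assoc, mul_smul_comm, mul_assoc, key1, key2, smul_sub,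
      smul_add]
    rw [pow_add _ m 2, pow_add _ m 1, pow_add _ m 2, pow_add _ m 1]
    generalize (p ^ 2)⁻¹ ^ m = t₁
    generalize (p ^ 2) ^ m = t₂
    match_scalars <;> field_simp <;> ring

lemma commute_aeval_of_commute {f : ℂ[X]} (h : Commute x y) : Commute (aeval x f) y := by
  have hx : x ∈ Subalgebra.centralizer ℂ {y} := by
    simpa [Subalgebra.mem_centralizer_iff] using h.eq.symm
  have hf : aeval x f ∈ Subalgebra.centralizer ℂ {y} :=
    Algebra.adjoin_le (Set.singleton_subset_iff.2 hx) (aeval_mem_adjoin_singleton ℂ x)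
  exact ((Subalgebra.mem_centralizer_iff ℂ).1 hf y rfl).symm

namespace IsCyclicTriple

lemma commute_aeval_middle (h : IsCyclicTriple p x y z) (hp : p ≠ 0) {k : ℕ}
    (hk : (p ^ 2) ^ k = 1) :
    Commute (aeval ((p ^ 2 - (p ^ 2)⁻¹) • x) (Chebyshev.C ℂ k)) y := by
  have H := aeval_chebyshev_C_mul hp h.left h.right k rfl
  have e : Chebyshev.C ℂ k = Chebyshev.S ℂ k - Chebyshev.S ℂ (k - 2) := by
    rw [Chebyshev.C_eq_S_sub_X_mul_S, Chebyshev.S_eq ℂ k]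
    ring
  rw [Commute, SemiconjBy, H, inv_pow, hk, e]
  simp

lemma commute_aeval_right (h : IsCyclicTriple p x y z) (hp : p ≠ 0) {k : ℕ}
    (hk : (p ^ 2) ^ k = 1) :
    Commute (aeval ((p ^ 2 - (p ^ 2)⁻¹) • x) (Chebyshev.C ℂ k)) z := by
  rw [← h.left]
  exact (commute_aeval_of_commute ((Commute.refl x).smul_left _)).qBracket_right
    (h.commute_aeval_middle hp hk)

end IsCyclicTriple

lemma natDegree_chebyshev_C (k : ℕ) : (Chebyshev.C ℂ k).natDegree = k := by
  have h := congrArg natDegree (Chebyshev.C_comp_two_mul_X ℂ (k : ℤ))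
  have h2 : (2 : ℂ[X]) = C 2 := rfl
  rw [natDegree_comp, h2, natDegree_C_mul_X _ two_ne_zero, natDegree_C_mul two_ne_zero,
    Chebyshev.natDegree_T] at h
  simpa using h

end Chebyshev

/-! ### Words in letters that commute up to lower weight -/

section WordFiltration

variable {K A ι : Type*} [Field K] [Ring A] [Algebra K A]

/-- The span of the words in the letters `x i` of total weight less than `m`. -/
def wordSpan (K : Type*) {A ι : Type*} [Field K] [Ring A] [Algebra K A] (x : ι → A) (wt : ι → ℕ)
    (m : ℕ) : Submodule K A :=
  Submodule.span K {a | ∃ w : List ι, (w.map wt).sum < m ∧ (w.map x).prod = a}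

variable {x : ι → A} {wt : ι → ℕ} {m : ℕ}

lemma span_range_words (hx : Algebra.adjoin K (Set.range x) = ⊤) :
    Submodule.span K (Set.range fun w : List ι => (w.map x).prod) = ⊤ := by
  rw [← Algebra.top_toSubmodule, ← hx, Algebra.adjoin_eq_span]
  congr 1
  ext b
  refine ⟨?_, fun hb => ?_⟩
  · rintro ⟨w, rfl⟩
    refine Submonoid.list_prod_mem _ fun y hy => ?_
    obtain ⟨i, -, rfl⟩ := List.mem_map.1 hy
    exact Submonoid.subset_closure ⟨i, rfl⟩
  · induction hb using Submonoid.closure_induction with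
    | mem _ h => obtain ⟨i, rfl⟩ := h; exact ⟨[i], by simp⟩
    | one => exact ⟨[], by simp⟩
    | mul _ _ _ _ h1 h2 =>
      obtain ⟨w, rfl⟩ := h1
      obtain ⟨v, rfl⟩ := h2
      exact ⟨w ++ v, by simp⟩

lemma prod_mem_wordSpan {w : List ι} (h : (w.map wt).sum < m) :
    (w.map x).prod ∈ wordSpan K x wt m :=
  Submodule.subset_span ⟨w, h, rfl⟩

lemma prod_mul_mem_wordSpan {a : A} (ha : a ∈ wordSpan K x wt m) (w : List ι) :
    (w.map x).prod * a ∈ wordSpan K x wt ((w.map wt).sum + m) := by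
  induction ha using Submodule.span_induction with
  | mem a ha =>
    obtain ⟨v, hv, rfl⟩ := ha
    rw [← List.prod_append, ← List.map_append]
    exact prod_mem_wordSpan (by simpa using hv)
  | zero => simp
  | add a b _ _ ha hb => rw [mul_add]; exact add_mem ha hb
  | smul c a _ ha => rw [mul_smul_comm]; exact Submodule.smul_mem _ _ ha

lemma mem_wordSpan_mul_prod {a : A} (ha : a ∈ wordSpan K x wt m) (w : List ι) :
    a * (w.map x).prod ∈ wordSpan K x wt (m + (w.map wt).sum) := by
  induction ha using Submodule.span_induction with
  | mem a ha =>
    obtain ⟨v, hv, rfl⟩ := ha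
    rw [← List.prod_append, ← List.map_append]
    exact prod_mem_wordSpan (by simpa using hv)
  | zero => simp
  | add a b _ _ ha hb => rw [add_mul]; exact add_mem ha hb
  | smul c a _ ha => rw [smul_mul_assoc]; exact Submodule.smul_mem _ _ ha

/-- The letters `x i` and `x j` commute up to a nonzero scalar and words of smaller weight than
`x i * x j`. -/
def QuasiCommutes (K : Type*) {A ι : Type*} [Field K] [Ring A] [Algebra K A] (x : ι → A)
    (wt : ι → ℕ) (i j : ι) : Prop :=
  ∃ c : K, c ≠ 0 ∧ x i * x j - c • (x j * x i) ∈ wordSpan K x wt (wt i + wt j)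

lemma QuasiCommutes.symm {i j : ι} (h : QuasiCommutes K x wt i j) : QuasiCommutes K x wt j i := by
  obtain ⟨c, hc, h⟩ := h
  refine ⟨c⁻¹, inv_ne_zero hc, ?_⟩
  have h1 := Submodule.smul_mem _ (-c⁻¹) h
  rw [add_comm (wt j)]
  convert h1 using 1
  rw [smul_sub, smul_smul, neg_mul, inv_mul_cancel₀ hc]
  module

lemma exists_smul_sub_mem_of_perm (h : ∀ i j, QuasiCommutes K x wt i j) {w v : List ι}
    (hwv : w.Perm v) :
    ∃ c : K, (w.map x).prod - c • (v.map x).prod ∈ wordSpan K x wt (w.map wt).sum := by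
  induction hwv with
  | nil => exact ⟨1, by simp⟩
  | @cons i w v _ ih =>
    obtain ⟨c, hc⟩ := ih
    refine ⟨c, ?_⟩
    have := prod_mul_mem_wordSpan hc [i]
    simpa [mul_sub] using this
  | swap i j w =>
    obtain ⟨c, -, hc⟩ := h j i
    refine ⟨c, ?_⟩
    have := mem_wordSpan_mul_prod hc w
    simpa [sub_mul, mul_assoc, add_assoc] using this
  | @trans u v w huv _ ih1 ih2 =>
    obtain ⟨c, hc⟩ := ih1
    obtain ⟨d, hd⟩ := ih2
    refine ⟨c * d, ?_⟩
    rw [← (huv.map wt).sum_eq] at hd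
    have := add_mem hc (Submodule.smul_mem _ c hd)
    simpa [smul_sub, smul_smul] using this

open Polynomial

lemma List.exists_lt_count_of_mul_lt_length [Fintype ι] [DecidableEq ι] {k : ℕ} {w : List ι}
    (hw : Fintype.card ι * k < w.length) : ∃ i, k < w.count i := by
  by_contra! h
  have : w.length ≤ Fintype.card ι * k := by
    calc w.length = ∑ i, w.count i := by
          simpa using (Multiset.sum_count_eq_card (s := Finset.univ) (m := (w : Multiset ι))
            (fun _ _ => Finset.mem_univ _)).symm
      _ ≤ ∑ _i : ι, k := Finset.sum_le_sum fun i _ => h i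
      _ = _ := by simp
  omega

/-- Suppose the letters commute up to scalars and terms of smaller weight, and a polynomial of
degree `k` in each letter is central. In a long word some letter occurs `k` times; moving these
occurrences to the front and expressing `x i ^ k` through the central element and lower powers
lowers the weight, so by induction the short words generate over the center. -/
theorem span_center_short_words [Fintype ι] {k : ℕ} (hk : 0 < k)
    (hx : Algebra.adjoin K (Set.range x) = ⊤) (hwt : ∀ i, 0 < wt i)
    (hcomm : ∀ i j, QuasiCommutes K x wt i j)
    (hcen : ∀ i, ∃ P : K[X], P.natDegree = k ∧ aeval (x i) P ∈ Subalgebra.center K A) :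
    Submodule.span (Subalgebra.center K A)
      ((fun w : List ι => (w.map x).prod) '' {w | w.length ≤ Fintype.card ι * (k - 1)}) = ⊤ := by
  classical
  set M := Submodule.span (Subalgebra.center K A)
      ((fun w : List ι => (w.map x).prod) '' {w | w.length ≤ Fintype.card ι * (k - 1)}) with hM
  have hword : ∀ m, wordSpan K x wt m ≤ M.restrictScalars K := by
    intro m
    induction m with
    | zero => 
      rw [wordSpan, Submodule.span_le]
      rintro _ ⟨w, hw, rfl⟩
      omega
    | succ m ih =>
      rw [wordSpan, Submodule.span_le]
      rintro _ ⟨w, hw, rfl⟩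
      rw [SetLike.mem_coe, Submodule.restrictScalars_mem]
      have ihw : wordSpan K x wt (w.map wt).sum ≤ M.restrictScalars K := by
        refine le_trans (Submodule.span_mono ?_) ih
        rintro _ ⟨v, hv, rfl⟩
        exact ⟨v, by omega, rfl⟩
      by_cases hl : w.length ≤ Fintype.card ι * (k - 1)
      · exact Submodule.subset_span ⟨w, hl, rfl⟩
      -- Some letter `x i` occurs at least `k` times; move these occurrences to the front.
      obtain ⟨i, hi⟩ := List.exists_lt_count_of_mul_lt_length (not_le.1 hl)
      have hsub : (List.replicate k i).Sublist w := List.replicate_sublist_iff.2 (by omega)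
      obtain ⟨v, hv⟩ := hsub.exists_perm_append
      obtain ⟨c, hc⟩ := exists_smul_sub_mem_of_perm hcomm hv
      have hsum : (w.map wt).sum = k * wt i + (v.map wt).sum := by
        rw [(hv.map wt).sum_eq]; simp
      have hki : 0 < k * wt i := Nat.mul_pos hk (hwt i)
      suffices h : x i ^ k * (v.map x).prod ∈ M by
        have h1 := add_mem (ihw hc) (Submodule.smul_mem (M.restrictScalars K) c h)
        simpa using h1
      obtain ⟨P, hP, hPc⟩ := hcen i
      have hlead : P.leadingCoeff ≠ 0 := by
        rw [Ne, leadingCoeff_eq_zero]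
        rintro rfl
        simp at hP
        omega
      have hlow : P.eraseLead.aeval (x i) * (v.map x).prod ∈ M := by
        rw [aeval_eq_sum_range, Finset.sum_mul]
        refine Submodule.sum_mem _ fun j hj => ?_
        have hj' : j < k := by
          have h1 := P.eraseLead_natDegree_le
          have := Finset.mem_range.1 hj
          omega
        rw [smul_mul_assoc]
        refine Submodule.smul_mem (M.restrictScalars K) _ (ihw ?_)
        have := prod_mem_wordSpan (K := K) (x := x) (wt := wt) (m := (w.map wt).sum)
          (w := List.replicate j i ++ v) (by
            rw [hsum]
            simpa using (Nat.mul_lt_mul_right (hwt i)).2 hj')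
        simpa using this
      have hcentral : aeval (x i) P * (v.map x).prod ∈ M := by
        refine M.smul_mem (⟨_, hPc⟩ : Subalgebra.center K A) (ihw (prod_mem_wordSpan ?_))
        omega
      have hdecomp : x i ^ k = P.leadingCoeff⁻¹ • (aeval (x i) P - aeval (x i) P.eraseLead) := by
        have h1 := congrArg (aeval (x i)) P.eraseLead_add_monomial_natDegree_leadingCoeff
        rw [map_add, aeval_monomial, hP, ← Algebra.smul_def] at h1
        rw [← h1, add_sub_cancel_left, smul_smul, inv_mul_cancel₀ hlead, one_smul]
      rw [hdecomp, smul_mul_assoc, sub_mul]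
      exact Submodule.smul_mem (M.restrictScalars K) _ (sub_mem hcentral hlow)
  rw [eq_top_iff]
  intro a _
  have ha : a ∈ Submodule.span K (Set.range fun w : List ι => (w.map x).prod) :=
    span_range_words hx ▸ Submodule.mem_top
  refine (Submodule.span_le (p := M.restrictScalars K)).2 ?_ ha
  rintro _ ⟨w, rfl⟩
  exact hword _ (prod_mem_wordSpan (Nat.lt_succ_self _))

end WordFiltration

/-! ### Simple modules over an algebra that is finite over its center -/

section SimpleModules

open Cardinal

/-- A field extension of `ℂ` of countable dimension is trivial: a transcendental `t` would make the
uncountable family `(t - a)⁻¹` linearly independent. -/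
lemma algebraMap_complex_surjective_of_rank_le_aleph0 {F : Type*} [Field F] [Algebra ℂ F]
    (h : Module.rank ℂ F ≤ ℵ₀) : Function.Surjective (algebraMap ℂ F) := by
  have halg : Algebra.IsAlgebraic ℂ F := by
    refine ⟨fun t => ?_⟩
    by_contra ht
    have h1 := (Transcendental.linearIndependent_sub_inv ht).cardinal_lift_le_rank
    have h2 := h1.trans (lift_le_aleph0.2 h)
    rw [lift_le_aleph0, mk_complex] at h2
    exact absurd h2 (not_le.2 aleph0_lt_continuum)
  exact IsAlgClosed.algebraMap_bijective_of_isIntegral.2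

variable {A : Type*} [Ring A] [Algebra ℂ A]

/-- Let `A` have countable dimension and be generated by the finite set `s` over its center `Z`.
For a simple module `V`, a central element not killing `V` acts surjectively on `V`, so Nakayama's
lemma makes the annihilator of `V` in `Z` maximal; its residue field is `ℂ`. So `Z` acts by scalars
and `V` is spanned over `ℂ` by `s • v` for any `v ≠ 0`. -/
theorem finrank_le_of_span_center (hA : Module.rank ℂ A ≤ ℵ₀) {s : Set A} (hs : s.Finite)
    (hspan : Submodule.span (Subalgebra.center ℂ A) s = ⊤)
    (V : Type*) [AddCommGroup V] [Module ℂ V] [Module A V] [IsScalarTower ℂ A V]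
    [IsSimpleModule A V] : FiniteDimensional ℂ V ∧ Module.finrank ℂ V ≤ s.ncard := by
  let Z := Subalgebra.center ℂ A
  have := IsSimpleModule.nontrivial A V
  obtain ⟨v, hv⟩ := exists_ne (0 : V)
  let φ : A →ₗ[Z] V := (LinearMap.toSpanSingleton A V v).restrictScalars Z
  have hφ : Function.Surjective φ := IsSimpleModule.toSpanSingleton_surjective A hv
  have hV : Submodule.span Z (φ '' s) = ⊤ := by
    rw [← Submodule.map_span, hspan, Submodule.map_top, LinearMap.range_eq_top.2 hφ]
  let I : Ideal Z := Module.annihilator Z V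
  have hmax : I.IsMaximal := by
    refine Ideal.isMaximal_iff.2 ⟨?_, fun J z hIJ hzI hzJ => ?_⟩
    · intro h
      exact hv (by simpa using Module.mem_annihilator.1 h v)
    let W : Submodule A V :=
      { carrier := Set.range fun w : V => z • w
        add_mem' := by
          rintro _ _ ⟨a, rfl⟩ ⟨b, rfl⟩
          exact ⟨a + b, smul_add _ _ _⟩
        zero_mem' := ⟨0, smul_zero _⟩
        smul_mem' := by
          rintro a _ ⟨b, rfl⟩
          refine ⟨a • b, ?_⟩
          change (z : A) • a • b = a • (z : A) • b
          rw [smul_smul, smul_smul, (Subalgebra.mem_center_iff.1 z.2 a)] }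
    have hW : W = ⊤ := by
      refine (eq_bot_or_eq_top W).resolve_left fun hb => hzI ?_
      refine Module.mem_annihilator.2 fun w => ?_
      have : z • w ∈ W := ⟨w, rfl⟩
      simpa [hb] using this
    have hfg : (⊤ : Submodule Z V).FG := Submodule.fg_def.2 ⟨_, hs.image φ, hV⟩
    obtain ⟨r, hr, hr0⟩ := Submodule.exists_sub_one_mem_and_smul_eq_zero_of_fg_of_le_smul
      (Ideal.span {z}) (⊤ : Submodule Z V) hfg (by
        intro w _
        obtain ⟨u, rfl⟩ : w ∈ W := hW ▸ Submodule.mem_top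
        exact Submodule.smul_mem_smul (Ideal.mem_span_singleton_self z) Submodule.mem_top)
    have h1 : r ∈ J := hIJ (Module.mem_annihilator.2 fun w => hr0 w Submodule.mem_top)
    have h2 : r - 1 ∈ J := (Ideal.span_singleton_le_iff_mem J).2 hzJ hr
    simpa using J.sub_mem h1 h2
  let := Ideal.Quotient.field I
  have hrank : Module.rank ℂ (Z ⧸ I) ≤ ℵ₀ :=
    ((Ideal.Quotient.mkₐ ℂ I).toLinearMap.rank_le_of_surjective
      Ideal.Quotient.mk_surjective).trans ((Submodule.rank_le (Subalgebra.toSubmodule Z)).trans hA)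
  have hscal : ∀ z : Z, ∃ c : ℂ, ∀ w : V, z • w = c • w := by
    intro z
    obtain ⟨c, hc⟩ := algebraMap_complex_surjective_of_rank_le_aleph0 hrank (Ideal.Quotient.mk I z)
    refine ⟨c, fun w => ?_⟩
    have h1 : algebraMap ℂ Z c - z ∈ I := Ideal.Quotient.eq.1 hc
    have h2 := Module.mem_annihilator.1 h1 w
    rw [sub_smul, sub_eq_zero] at h2
    rw [← h2]
    change algebraMap ℂ A c • w = c • w
    rw [algebraMap_smul]
  have hVC : Submodule.span ℂ (φ '' s) = ⊤ := by
    rw [eq_top_iff]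
    intro w _
    have hw : w ∈ Submodule.span Z (φ '' s) := hV ▸ Submodule.mem_top
    induction hw using Submodule.span_induction with
    | mem w hw => exact Submodule.subset_span hw
    | zero => exact zero_mem _
    | add a b _ _ ha hb => exact add_mem (ha trivial) (hb trivial)
    | smul z a _ ha =>
      obtain ⟨c, hc⟩ := hscal z
      rw [hc]
      exact Submodule.smul_mem _ _ (ha trivial)
  have hfin : (φ '' s).Finite := hs.image φ
  refine ⟨⟨Submodule.fg_def.2 ⟨_, hfin, hVC⟩⟩, ?_⟩
  have := hfin.fintype
  have h1 := finrank_span_le_card (R := ℂ) (φ '' s)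
  rw [hVC, finrank_top] at h1
  refine h1.trans ?_
  rw [← Set.ncard_eq_toFinset_card']
  exact Set.ncard_image_le hs

end SimpleModules

/-! ### The weight filtration for chords -/

section Chords

/-- The filtration weight of a chord of length `d` in a polygon with `n` vertices. It is increasing
and strictly concave for `d ≤ n`, so that in every relation between two chords the correction terms
have smaller weight. -/
def chordWeight (n d : ℕ) : ℕ := d * (2 * n - d)

lemma chordWeight_pos {n d : ℕ} (h : 0 < d) (hd : d ≤ n) : 0 < chordWeight n d :=
  Nat.mul_pos h (by omega)

lemma chordWeight_lt {n d e : ℕ} (h : d < e) (he : e ≤ n) : chordWeight n d < chordWeight n e := by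
  obtain ⟨s, rfl⟩ := Nat.exists_eq_add_of_lt h
  obtain ⟨t, rfl⟩ := Nat.exists_eq_add_of_le he
  have h1 : 2 * (d + s + 1 + t) - d = d + 2 * s + 2 + 2 * t := by omega
  have h2 : 2 * (d + s + 1 + t) - (d + s + 1) = d + s + 1 + 2 * t := by omega
  rw [chordWeight, chordWeight, h1, h2]
  nlinarith [Nat.zero_le (d * s), Nat.zero_le (d * t), Nat.zero_le (s * t)]

lemma chordWeight_concave {n a b c : ℕ} (ha : 0 < a) (hc : 0 < c) (h : a + b + c ≤ n) :
    chordWeight n (a + b + c) + chordWeight n b <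
      chordWeight n (a + b) + chordWeight n (b + c) := by
  obtain ⟨t, rfl⟩ := Nat.exists_eq_add_of_le h
  have h1 : 2 * (a + b + c + t) - (a + b + c) = a + b + c + 2 * t := by omega
  have h2 : 2 * (a + b + c + t) - b = 2 * a + b + 2 * c + 2 * t := by omega
  have h3 : 2 * (a + b + c + t) - (a + b) = a + b + 2 * c + 2 * t := by omega
  have h4 : 2 * (a + b + c + t) - (b + c) = 2 * a + b + c + 2 * t := by omega
  rw [chordWeight, chordWeight, chordWeight, chordWeight, h1, h2, h3, h4]
  nlinarith [Nat.mul_pos ha hc]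

lemma chordWeight_add_lt {n a c : ℕ} (ha : 0 < a) (hc : 0 < c) (h : a + c ≤ n) :
    chordWeight n (a + c) < chordWeight n a + chordWeight n c := by
  have := chordWeight_concave (b := 0) ha hc (by omega : a + 0 + c ≤ n)
  simpa [chordWeight] using this

/-- The chords of a polygon with vertices `0, …, n - 1`, as increasing pairs of vertices. -/
abbrev Chord (n : ℕ) : Type := {e : Fin n × Fin n // e.1 < e.2}

variable {A : Type*} [Ring A] [Algebra ℂ A] {p : ℂ} {g : ℕ → A} {n : ℕ}

/-- The family of all the `chord p g l k`, indexed by `Chord n`. -/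
noncomputable def chordFamily (p : ℂ) (g : ℕ → A) (n : ℕ) (e : Chord n) : A :=
  chord p g e.1.1 e.1.2

/-- The weight of a chord, as a function on `Chord n`. -/
def Chord.weight {n : ℕ} (e : Chord n) : ℕ := chordWeight n (e.1.2 - e.1.1)

/-- The chord with end points `l < k`. -/
def Chord.mk {n : ℕ} (l k : ℕ) (hlk : l < k) (hk : k < n) : Chord n :=
  ⟨(⟨l, hlk.trans hk⟩, ⟨k, hk⟩), hlk⟩

lemma chord_mem_wordSpan {l k m : ℕ} (hlk : l < k) (hk : k < n) (hm : chordWeight n (k - l) < m) :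
    chord p g l k ∈ wordSpan ℂ (chordFamily p g n) Chord.weight m := by
  have := prod_mem_wordSpan (K := ℂ) (x := chordFamily p g n) (wt := Chord.weight) (m := m)
    (w := [Chord.mk l k hlk hk]) (by simpa [Chord.weight, Chord.mk] using hm)
  simpa [chordFamily, Chord.mk] using this

lemma chord_mul_chord_mem_wordSpan {l k r s m : ℕ} (hlk : l < k) (hk : k < n) (hrs : r < s)
    (hs : s < n) (hm : chordWeight n (k - l) + chordWeight n (s - r) < m) :
    chord p g l k * chord p g r s ∈ wordSpan ℂ (chordFamily p g n) Chord.weight m := by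
  have := prod_mem_wordSpan (K := ℂ) (x := chordFamily p g n) (wt := Chord.weight) (m := m)
    (w := [Chord.mk l k hlk hk, Chord.mk r s hrs hs])
    (by simpa [Chord.weight, Chord.mk] using hm)
  simpa [chordFamily, Chord.mk] using this

lemma quasiCommutes_of_commute {ι : Type*} {x : ι → A} {wt : ι → ℕ} {i j : ι}
    (h : Commute (x i) (x j)) : QuasiCommutes ℂ x wt i j :=
  ⟨1, one_ne_zero, by rw [one_smul, h.eq, sub_self]; exact zero_mem _⟩

lemma quasiCommutes_of_qBracket {ι : Type*} {x : ι → A} {wt : ι → ℕ} {i j : ι} (hp : p ≠ 0)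
    (h : qBracket p (x i) (x j) ∈ wordSpan ℂ x wt (wt i + wt j)) : QuasiCommutes ℂ x wt i j := by
  refine ⟨(p ^ 2)⁻¹, inv_ne_zero (pow_ne_zero 2 hp), ?_⟩
  rw [qBracket_mul_left hp rfl, add_sub_cancel_left]
  exact Submodule.smul_mem _ _ h

lemma IsSoGenerators.quasiCommutes_chords (hg : IsSoGenerators p (n - 1) g) (hp : p ≠ 0)
    (hp8 : p ^ 8 ≠ 1) (e e' : Chord n) :
    QuasiCommutes ℂ (chordFamily p g n) Chord.weight e e' := by
  -- The relation is symmetric, so the pair may be ordered lexicographically.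
  wlog hee : (e.1.1 : ℕ) < e'.1.1 ∨ (e.1.1 : ℕ) = e'.1.1 ∧ (e.1.2 : ℕ) ≤ e'.1.2 generalizing e e'
  · exact (this e' e (by omega)).symm
  obtain ⟨⟨⟨l, hl⟩, ⟨k, hk⟩⟩, hlk⟩ := e
  obtain ⟨⟨⟨r, hr⟩, ⟨s, hs⟩⟩, hrs⟩ := e'
  simp only [Fin.mk_lt_mk] at hlk hrs
  simp only at hee
  rcases hee with hlr | ⟨rfl, hks⟩
  · rcases lt_trichotomy k r with hkr | rfl | hrk
    · exact quasiCommutes_of_commute (hg.commute_of_separated hlk hkr hrs (by omega))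
    · -- consecutive chords
      refine quasiCommutes_of_qBracket hp ?_
      simp only [chordFamily, Chord.weight]
      rw [(hg.chord_triple hp hp8 hlk hrs (by omega)).left]
      refine chord_mem_wordSpan (by omega) hs ?_
      have := chordWeight_add_lt (n := n) (a := k - l) (c := s - k) (by omega) (by omega) (by omega)
      rwa [show k - l + (s - k) = s - l by omega] at this
    · rcases lt_trichotomy s k with hsk | rfl | hks
      · exact quasiCommutes_of_commute
          ((hg.isFourPoint hp hp8 hlr hrs hsk (by omega)).commute_middle_outer hp hp8).symm
      · -- common right end
        refine (quasiCommutes_of_qBracket hp ?_).symm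
        simp only [chordFamily, Chord.weight]
        rw [(hg.chord_triple hp hp8 hlr hrs (by omega)).middle]
        refine chord_mem_wordSpan (by omega) hr ?_
        have := chordWeight_lt (n := n) (d := r - l) (e := s - l) (by omega) (by omega)
        omega
      · -- crossing chords
        refine ⟨1, one_ne_zero, ?_⟩
        simp only [chordFamily, Chord.weight, one_smul]
        rw [(hg.isFourPoint hp hp8 hlr hrk hks (by omega)).crossing hp hp8]
        have h1 := chordWeight_concave (n := n) (a := r - l) (b := k - r) (c := s - k) (by omega)
          (by omega) (by omega)
        rw [show r - l + (k - r) + (s - k) = s - l by omega,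
          show r - l + (k - r) = k - l by omega, show k - r + (s - k) = s - r by omega] at h1
        have h2 := chordWeight_lt (n := n) (d := r - l) (e := k - l) (by omega) (by omega)
        have h3 := chordWeight_lt (n := n) (d := s - k) (e := s - r) (by omega) (by omega)
        exact Submodule.smul_mem _ _ (sub_mem
          (chord_mul_chord_mem_wordSpan (by omega) hs hrk hk (by omega))
          (chord_mul_chord_mem_wordSpan hlr hr hks hs (by omega)))
  · rcases hks.lt_or_eq with hks | rfl
    · -- common left end
      refine (quasiCommutes_of_qBracket hp ?_).symm
      simp only [chordFamily, Chord.weight]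
      rw [(hg.chord_triple hp hp8 hlk hks (by omega)).right]
      refine chord_mem_wordSpan hks hs ?_
      have := chordWeight_lt (n := n) (d := s - k) (e := s - l) (by omega) (by omega)
      omega
    · exact quasiCommutes_of_commute (Commute.refl _)

open Polynomial in
/-- A generator `g j` either commutes with the chord or forms a cyclic triple with it, so it
commutes with the Chebyshev polynomial of the rescaled chord. -/
lemma IsSoGenerators.commute_aeval_chord {N : ℕ} (hg : IsSoGenerators p N g) (hp : p ≠ 0)
    (hp8 : p ^ 8 ≠ 1) {k : ℕ} (hk : (p ^ 2) ^ k = 1) {l m j : ℕ} (hlm : l < m) (hm : m ≤ N)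
    (hj : j < N) :
    Commute (aeval ((p ^ 2 - (p ^ 2)⁻¹) • chord p g l m) (Chebyshev.C ℂ k)) (g j) := by
  have hcomm (h : Commute (chord p g l m) (g j)) :
      Commute (aeval ((p ^ 2 - (p ^ 2)⁻¹) • chord p g l m) (Chebyshev.C ℂ k)) (g j) :=
    commute_aeval_of_commute (h.smul_left _)
  rw [← chord_succ (p := p) (g := g) j] at hcomm ⊢
  have hjj : j < j + 1 := Nat.lt_succ_self j
  rcases lt_trichotomy l j with h1 | rfl | h1
  · rcases lt_trichotomy m (j + 1) with h2 | rfl | h2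
    · rcases (Nat.lt_succ_iff.1 h2).lt_or_eq with h3 | rfl
      · exact hcomm (hg.commute_of_separated hlm h3 hjj (by omega))
      · exact (hg.chord_triple hp hp8 hlm hjj (by omega)).commute_aeval_middle hp hk
    · exact (hg.chord_triple hp hp8 h1 hjj hm).rotate.rotate.commute_aeval_right hp hk
    · exact hcomm ((hg.isFourPoint hp hp8 h1 hjj h2 hm).commute_middle_outer hp hp8).symm
  · rcases (Nat.succ_le_iff.2 hlm).lt_or_eq with h2 | rfl
    · exact (hg.chord_triple hp hp8 hjj h2 hm).rotate.rotate.commute_aeval_middle hp hk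
    · exact hcomm (Commute.refl _)
  · rcases (Nat.succ_le_iff.2 h1).lt_or_eq with h2 | rfl
    · exact hcomm (hg.commute_of_separated hjj h2 hlm hm).symm
    · exact (hg.chord_triple hp hp8 hjj hlm hm).rotate.commute_aeval_right hp hk

end Chords

/-! ### The algebra `U'_q(so_n)` -/

section Presentation

variable {q : ℂ} {n : ℕ}

/-- The generator `I_{i+2,i+1}` of `U'_q(so_n)`, extended by zero to all natural numbers `i`. -/
noncomputable def uqSoGen (q : ℂ) (n i : ℕ) : UqSo q n :=
  if h : i < n - 1 then RingQuot.mkAlgHom ℂ (UqSoRel q n) (FreeAlgebra.ι ℂ ⟨i, h⟩) else 0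

lemma uqSoGen_of_lt {i : ℕ} (h : i < n - 1) :
    uqSoGen q n i = RingQuot.mkAlgHom ℂ (UqSoRel q n) (FreeAlgebra.ι ℂ ⟨i, h⟩) := dif_pos h

lemma isSoGenerators_uqSoGen {p : ℂ} (hp : p ≠ 0) (hq : p ^ 2 = q) :
    IsSoGenerators p (n - 1) (uqSoGen q n) := by
  subst hq
  constructor
  · intro i hi
    have hi' : i < n - 1 := by omega
    have h1 := RingQuot.mkAlgHom_rel ℂ
      (UqSoRel.serre_left (q := p ^ 2) (n := n) ⟨i, hi'⟩ ⟨i + 1, hi⟩ rfl)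
    have h2 := RingQuot.mkAlgHom_rel ℂ
      (UqSoRel.serre_right (q := p ^ 2) (n := n) ⟨i, hi'⟩ ⟨i + 1, hi⟩ rfl)
    simp only [map_add, map_sub, map_mul, map_smul, map_pow, map_neg] at h1 h2
    rw [← uqSoGen_of_lt, ← uqSoGen_of_lt] at h1 h2
    exact isCyclicTriple_of_serre hp h1 h2
  · intro i j hij hj
    have h1 := RingQuot.mkAlgHom_rel ℂ (UqSoRel.comm (q := p ^ 2) (n := n) ⟨i, by omega⟩ ⟨j, hj⟩
      (by rw [lt_abs]; right; push_cast; omega))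
    simp only [map_sub, map_mul, map_zero] at h1
    rw [← uqSoGen_of_lt, ← uqSoGen_of_lt] at h1
    exact sub_eq_zero.1 h1

lemma adjoin_uqSoGen : Algebra.adjoin ℂ (uqSoGen q n '' Set.Iio (n - 1)) = ⊤ := by
  have h := congrArg (Subalgebra.map (RingQuot.mkAlgHom ℂ (UqSoRel q n)))
    (FreeAlgebra.adjoin_range_ι ℂ (Fin (n - 1)))
  rw [AlgHom.map_adjoin, Algebra.map_top,
    (AlgHom.range_eq_top _).2 (RingQuot.mkAlgHom_surjective ℂ _)] at h
  rw [← h]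
  congr 1
  ext a
  constructor
  · rintro ⟨i, hi, rfl⟩
    exact ⟨_, ⟨⟨i, hi⟩, rfl⟩, (uqSoGen_of_lt hi).symm⟩
  · rintro ⟨_, ⟨i, rfl⟩, rfl⟩
    exact ⟨i, i.2, uqSoGen_of_lt i.2⟩

lemma adjoin_chordFamily (p : ℂ) :
    Algebra.adjoin ℂ (Set.range (chordFamily p (uqSoGen q n) n)) = ⊤ := by
  rw [eq_top_iff, ← adjoin_uqSoGen]
  refine Algebra.adjoin_mono ?_
  rintro _ ⟨i, hi, rfl⟩
  have hi : i < n - 1 := hi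
  exact ⟨Chord.mk i (i + 1) (Nat.lt_succ_self i) (by omega), chord_succ i⟩

open Polynomial in
lemma aeval_chordFamily_mem_center {p : ℂ} (hp : p ≠ 0) (hq : p ^ 2 = q) (hp8 : p ^ 8 ≠ 1) {k : ℕ}
    (hk : q ^ k = 1) (e : Chord n) :
    aeval ((p ^ 2 - (p ^ 2)⁻¹) • chordFamily p (uqSoGen q n) n e) (Chebyshev.C ℂ k) ∈
      Subalgebra.center ℂ (UqSo q n) := by
  set a := aeval ((p ^ 2 - (p ^ 2)⁻¹) • chordFamily p (uqSoGen q n) n e) (Chebyshev.C ℂ k)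
  have h : (⊤ : Subalgebra ℂ (UqSo q n)) ≤ Subalgebra.centralizer ℂ {a} := by
    rw [← adjoin_uqSoGen]
    refine Algebra.adjoin_le ?_
    rintro _ ⟨j, hj, rfl⟩
    have h1 := (isSoGenerators_uqSoGen (n := n) hp hq).commute_aeval_chord hp hp8
      (by rw [hq, hk]) e.2 (by omega) hj
    refine (Subalgebra.mem_centralizer_iff ℂ).2 fun b hb => ?_
    rw [Set.mem_singleton_iff.1 hb]
    exact h1.eq
  refine Subalgebra.mem_center_iff.2 fun b => ?_
  exact ((Subalgebra.mem_centralizer_iff ℂ).1 (h (Algebra.mem_top (x := b))) a rfl).symm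

open Polynomial in
lemma span_center_chord_words {k : ℕ} (hk : 0 < k) {p : ℂ} (hp : p ≠ 0) (hq : p ^ 2 = q)
    (hp8 : p ^ 8 ≠ 1) (hqk : q ^ k = 1) :
    Submodule.span (Subalgebra.center ℂ (UqSo q n))
      ((fun w : List (Chord n) => (w.map (chordFamily p (uqSoGen q n) n)).prod) ''
        {w | w.length ≤ Fintype.card (Chord n) * (k - 1)}) = ⊤ := by
  have hg := isSoGenerators_uqSoGen (n := n) hp hq
  have hne : p ^ 2 - (p ^ 2)⁻¹ ≠ 0 := by
    intro h
    have h4 : p ^ 4 = 1 := by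
      field_simp at h
      linear_combination h
    exact hp8 (by linear_combination (p ^ 4 + 1) * h4)
  refine span_center_short_words (wt := Chord.weight) hk (adjoin_chordFamily p)
    (fun e => chordWeight_pos (by have := e.2; omega) (by omega))
    (fun e e' => hg.quasiCommutes_chords hp hp8 e e') fun e => ?_
  -- `q² ≠ 1` keeps the degree of the rescaled polynomial equal to `k`.
  refine ⟨(Chebyshev.C ℂ k).comp (C (p ^ 2 - (p ^ 2)⁻¹) * X), ?_, ?_⟩
  · rw [natDegree_comp, natDegree_chebyshev_C, natDegree_C_mul_X _ hne, mul_one]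
  · rw [aeval_comp, map_mul, aeval_C, aeval_X, ← Algebra.smul_def]
    exact aeval_chordFamily_mem_center hp hq hp8 hqk e

end Presentation

theorem theorem5 (n k : ℕ) (hk : 0 < k) :
    ∃ r : ℕ, ∀ q : ℂ, q ^ k = 1 → q ^ 4 ≠ 1 →
      Module.Finite (Subalgebra.center ℂ (UqSo q n)) (UqSo q n) ∧
      ∀ (V : Type*) [AddCommGroup V] [Module ℂ V] [Module (UqSo q n) V]
        [IsScalarTower ℂ (UqSo q n) V] [IsSimpleModule (UqSo q n) V],
        FiniteDimensional ℂ V ∧ Module.finrank ℂ V ≤ r := by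
  refine ⟨{w : List (Chord n) | w.length ≤ Fintype.card (Chord n) * (k - 1)}.ncard,
    fun q hqk hq4 => ?_⟩
  obtain ⟨p, hq⟩ := IsAlgClosed.exists_pow_nat_eq q two_pos
  have hp : p ≠ 0 := by
    rintro rfl
    rw [← hq, zero_pow two_ne_zero, zero_pow hk.ne'] at hqk
    exact zero_ne_one hqk
  have hp8 : p ^ 8 ≠ 1 := fun h => hq4 (by rw [← hq, ← pow_mul]; exact h)
  have hfin := List.finite_length_le (Chord n) (Fintype.card (Chord n) * (k - 1))
  have hspan := span_center_chord_words (n := n) hk hp hq hp8 hqk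
  refine ⟨⟨Submodule.fg_def.2 ⟨_, hfin.image _, hspan⟩⟩, fun V => ?_⟩
  intro _ _ _ _ _
  have hrank : Module.rank ℂ (UqSo q n) ≤ Cardinal.aleph0 := by
    rw [← rank_top, ← span_range_words (adjoin_chordFamily p)]
    exact (rank_span_le _).trans (Set.countable_range _).le_aleph0
  obtain ⟨h1, h2⟩ := finrank_le_of_span_center hrank (hfin.image _) hspan V
  exact ⟨h1, h2.trans (Set.ncard_image_le hfin)⟩
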